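/- Let $\Gamma=(V,E)$ be a finite simple graph, and let $A_\Gamma^+=\langle e_i\ (i\in V): e_ie_j=e_je_i \text{ if } ij\in E\rangle$ be its right-angled Artin monoid. For $p\in A_\Gamma^+$ let $|p|$ be the number of generators, counted with multiplicity, in any expression of $p$. For a finite subset $S\subseteq A_\Gamma^+$ write $\vee S=r$ if $\bigcap_{p\in S}pA_\Gamma^+=rA_\Gamma^+$ (such an $r$ is unique), and $\vee S=\infty$ if there is no such $r$. Let $\mathcal H$ be a complex Hilbert space. A $\Gamma$-family on $\mathcal H$ is a family $\{T_j\}_{j\in V}$ of contractions in $\mathcal B(\mathcal H)$ such that $T_iT_j=T_jT_i$ whenever $ij\in E$; write $p\mapsto T_p$ for the unital representation of $A_\Gamma^+$ with $T_{e_j}=T_j$, and put $T_\infty=0$. A $\Gamma$-family satisfies Brehmer's condition if for every clique $W$ of $\Gamma$ (including $W=\emptyset$) \[\sum_{U\subseteq N_\Gamma(W)}(-1)^{|U|}\,T_{\vee U}T_{\vee U}^*\ \ge\ 0,\qquad N_\Gamma(W)=\{e_i: ij\in E\text{ for all }j\in W\}.\] It satisfies the weak Brehmer condition if, for every connected component $C$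 of the complement graph $\Gamma^c$, the family $\{T_j\}_{j\in C}$ satisfies Brehmer's condition as a $\Gamma|_C$-family, where $\Gamma|_C$ is the subgraph of $\Gamma$ induced on $C$. Theorem. Let $\{T_j\}_{j\in V}$ be a $\Gamma$-family on $\mathcal H$ that satisfies the weak Brehmer condition, let $\omega$ be the clique number of $\Gamma$, and let $0\le r<1$. Then for every $h\in\mathcal H$ the series \[C_{r,T}h=\sum_{p\in A_\Gamma^+}e_p\otimes r^{|p|}T_p^*h\] converges (unconditionally) in the Hilbert space tensor product $\ell^2(A_\Gamma^+)\otimes\mathcal H$, where $\{e_p\}$ is the canonical orthonormal basis of $\ell^2(A_\Gamma^+)$ and $0^0=1$; the Cauchy transform $C_{r,T}:\mathcal H\to\ell^2(A_\Gamma^+)\otimes\mathcal H$ is a bounded linear map; and \[\|C_{r,T}h\|^2\le\frac{1}{(1-r^2)^{\omega}}\|h\|^2\qquad\text{for all }h\in\mathcal H.\] -/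

import Mathlib

open scoped TensorProduct ENNReal

noncomputable section

/-- The defining relations `e_i e_j = e_j e_i`, for `ij` an edge of `Γ`. -/
inductive ArtinRel {V : Type*} (Γ : SimpleGraph V) : FreeMonoid V → FreeMonoid V → Prop
  | comm (i j : V) (hij : Γ.Adj i j) :
      ArtinRel Γ (FreeMonoid.of i * FreeMonoid.of j) (FreeMonoid.of j * FreeMonoid.of i)

/-- The right-angled Artin monoid `A_Γ⁺ = ⟨ e_i (i ∈ V) : e_i e_j = e_j e_i if ij ∈ E ⟩`. -/
abbrev ArtinMonoid {V : Type*} (Γ : SimpleGraph V) : Type _ := PresentedMonoid (ArtinRel Γ)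

namespace ArtinMonoid

/-- The generator `e_i`. -/
def gen {V : Type*} (Γ : SimpleGraph V) (i : V) : ArtinMonoid Γ :=
  PresentedMonoid.of (ArtinRel Γ) i

/-- The monoid homomorphism to `(ℕ, +)` that sends every generator to `1`. -/
def lengthHom {V : Type*} (Γ : SimpleGraph V) : ArtinMonoid Γ →* Multiplicative ℕ :=
  PresentedMonoid.lift (fun _ => Multiplicative.ofAdd 1) (by
    rintro _ _ ⟨i, j, _⟩
    rfl)

/-- `|p|`, the number of generators (with multiplicity) in any expression of `p`. -/
def length {V : Type*} {Γ : SimpleGraph V} (p : ArtinMonoid Γ) : ℕ :=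
  Multiplicative.toAdd (lengthHom Γ p)

theorem length_mul {V : Type*} {Γ : SimpleGraph V} (p q : ArtinMonoid Γ) :
    length (p * q) = length p + length q := by
  simp [length]

theorem length_mk_of_mul {V : Type*} {Γ : SimpleGraph V} (i : V) (l : FreeMonoid V) :
    length (Γ := Γ) (PresentedMonoid.mk (ArtinRel Γ) (FreeMonoid.of i * l))
      = 1 + length (Γ := Γ) (PresentedMonoid.mk (ArtinRel Γ) l) := by
  rw [map_mul, length_mul]
  rfl

theorem eq_one_of_length_eq_zero {V : Type*} {Γ : SimpleGraph V} (p : ArtinMonoid Γ)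
    (hp : length p = 0) : p = 1 := by
  obtain ⟨l, rfl⟩ := PresentedMonoid.surjective_mk p
  induction l using FreeMonoid.casesOn with
  | one => exact map_one _
  | of_mul i l =>
    rw [length_mk_of_mul] at hp
    omega

/-- `r = ∨ S`: the common right multiples of the elements of `S` are exactly the right multiples
of `r`, i.e. `⋂_{p ∈ S} p A_Γ⁺ = r A_Γ⁺`. (`p ∣ x` means `x = p * y` for some `y`.)
If there is no such `r`, then `∨ S = ∞`. -/
def IsJoin {V : Type*} {Γ : SimpleGraph V} (S : Set (ArtinMonoid Γ)) (r : ArtinMonoid Γ) : Prop :=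
  ∀ x : ArtinMonoid Γ, (∀ p ∈ S, p ∣ x) ↔ r ∣ x

theorem IsJoin.unique {V : Type*} {Γ : SimpleGraph V} {S : Set (ArtinMonoid Γ)}
    {r s : ArtinMonoid Γ} (hr : IsJoin S r) (hs : IsJoin S s) : r = s := by
  obtain ⟨a, ha⟩ : r ∣ s := (hr s).1 ((hs s).2 (dvd_refl s))
  obtain ⟨b, hb⟩ : s ∣ r := (hs r).1 ((hr r).2 (dvd_refl r))
  have h1 := congrArg length ha
  have h2 := congrArg length hb
  rw [length_mul] at h1 h2
  rw [ha, eq_one_of_length_eq_zero a (by omega), mul_one]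

end ArtinMonoid

/-- A `Γ`-family: contractions `T_j` on `H` such that `T_i` and `T_j` commute whenever `ij` is an
edge of `Γ`. -/
structure IsGammaFamily {V : Type*} (Γ : SimpleGraph V) {H : Type*} [NormedAddCommGroup H]
    [InnerProductSpace ℂ H] (T : V → H →L[ℂ] H) : Prop where
  norm_le_one : ∀ j, ‖T j‖ ≤ 1
  commute : ∀ i j, Γ.Adj i j → Commute (T i) (T j)

namespace IsGammaFamily

/-- The representation `p ↦ T_p` of `A_Γ⁺` with `T_{e_j} = T_j`. -/
def rep {V : Type*} {Γ : SimpleGraph V} {H : Type*} [NormedAddCommGroup H]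
    [InnerProductSpace ℂ H] {T : V → H →L[ℂ] H} (hT : IsGammaFamily Γ T) :
    ArtinMonoid Γ →* (H →L[ℂ] H) :=
  PresentedMonoid.lift T (by
    rintro _ _ ⟨i, j, hij⟩
    simpa using (hT.commute i j hij).eq)

/-- The restriction of a `Γ`-family to a set `s` of vertices is a `Γ|_s`-family. -/
theorem restrict {V : Type*} {Γ : SimpleGraph V} {H : Type*} [NormedAddCommGroup H]
    [InnerProductSpace ℂ H] {T : V → H →L[ℂ] H} (hT : IsGammaFamily Γ T) (s : Set V) :
    IsGammaFamily (Γ.induce s) (fun j : s => T j) :=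
  ⟨fun j => hT.norm_le_one j, fun i j hij => hT.commute i j hij⟩

open Classical in
/-- `T_{∨ S}`, where `T_{∨ S} = 0` if `∨ S = ∞`. -/
def repJoin {V : Type*} {Γ : SimpleGraph V} {H : Type*} [NormedAddCommGroup H]
    [InnerProductSpace ℂ H] {T : V → H →L[ℂ] H} (hT : IsGammaFamily Γ T)
    (S : Set (ArtinMonoid Γ)) : H →L[ℂ] H :=
  if h : ∃ r, ArtinMonoid.IsJoin S r then hT.rep h.choose else 0

theorem repJoin_eq {V : Type*} {Γ : SimpleGraph V} {H : Type*} [NormedAddCommGroup H]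
    [InnerProductSpace ℂ H] {T : V → H →L[ℂ] H} (hT : IsGammaFamily Γ T)
    {S : Set (ArtinMonoid Γ)} {r : ArtinMonoid Γ} (hr : ArtinMonoid.IsJoin S r) :
    hT.repJoin S = hT.rep r := by
  have h : ∃ r, ArtinMonoid.IsJoin S r := ⟨r, hr⟩
  rw [repJoin, dif_pos h, h.choose_spec.unique hr]

/-- `Z(A) = ∑_{U ⊆ A} (-1)^{|U|} T_{∨U} T_{∨U}^*` for a finite set `A` of vertices, a vertex `i`
standing for the generator `e_i`. -/
def brehmerZ {V : Type*} {Γ : SimpleGraph V} {H : Type*} [NormedAddCommGroup H]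
    [InnerProductSpace ℂ H] [CompleteSpace H] {T : V → H →L[ℂ] H} (hT : IsGammaFamily Γ T)
    (A : Finset V) : H →L[ℂ] H :=
  ∑ U ∈ A.powerset, (-1 : ℂ) ^ U.card •
    (hT.repJoin (ArtinMonoid.gen Γ '' (U : Set V)) *
      ContinuousLinearMap.adjoint (hT.repJoin (ArtinMonoid.gen Γ '' (U : Set V))))

end IsGammaFamily

/-- `N_Γ(W)`, the set of vertices adjacent to every vertex in `W`. -/
def commonNbhd {V : Type*} [Finite V] (Γ : SimpleGraph V) (W : Set V) : Finset V :=
  (Set.toFinite {i : V | ∀ j ∈ W, Γ.Adj i j}).toFinset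

namespace IsGammaFamily

/-- Brehmer's condition: `Z(N_Γ(W)) ≥ 0` for every clique `W` of `Γ` (the empty one included). -/
def Brehmer {V : Type*} [Finite V] {Γ : SimpleGraph V} {H : Type*} [NormedAddCommGroup H]
    [InnerProductSpace ℂ H] [CompleteSpace H] {T : V → H →L[ℂ] H}
    (hT : IsGammaFamily Γ T) : Prop :=
  ∀ W : Set V, Γ.IsClique W → (hT.brehmerZ (commonNbhd Γ W)).IsPositive

/-- The weak Brehmer condition: for each connected component `C` of the complement graph, the
family `{T_j : j ∈ C}` satisfies Brehmer's condition as a `Γ|_C`-family. -/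
def WeakBrehmer {V : Type*} [Finite V] {Γ : SimpleGraph V} {H : Type*} [NormedAddCommGroup H]
    [InnerProductSpace ℂ H] [CompleteSpace H] {T : V → H →L[ℂ] H}
    (hT : IsGammaFamily Γ T) : Prop :=
  ∀ C : Γᶜ.ConnectedComponent, (hT.restrict C.supp).Brehmer

end IsGammaFamily

/-- The Hilbert space tensor product `ℓ²(A_Γ⁺) ⊗ H`: the completion of the algebraic tensor
product with respect to the inner product `⟨a ⊗ h, b ⊗ k⟩ = ⟨a, b⟩ ⟨h, k⟩`. -/
abbrev CauchySpace {V : Type*} (Γ : SimpleGraph V) (H : Type*) [NormedAddCommGroup H]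
    [InnerProductSpace ℂ H] : Type _ :=
  UniformSpace.Completion (lp (fun _ : ArtinMonoid Γ => ℂ) 2 ⊗[ℂ] H)

open Classical in
/-- The canonical basis vector `e_p` of `ℓ²(A_Γ⁺)`. -/
def ell2Basis {V : Type*} {Γ : SimpleGraph V} (p : ArtinMonoid Γ) :
    lp (fun _ : ArtinMonoid Γ => ℂ) 2 :=
  lp.single 2 p (1 : ℂ)

namespace IsGammaFamily

/-- The vector `e_p ⊗ r^{|p|} T_p^* h`. -/
def cauchyTerm {V : Type*} {Γ : SimpleGraph V} {H : Type*} [NormedAddCommGroup H]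
    [InnerProductSpace ℂ H] [CompleteSpace H] {T : V → H →L[ℂ] H} (hT : IsGammaFamily Γ T)
    (r : ℝ) (h : H) (p : ArtinMonoid Γ) : CauchySpace Γ H :=
  ((ell2Basis p ⊗ₜ[ℂ]
    (((r : ℂ) ^ ArtinMonoid.length p) • ContinuousLinearMap.adjoint (hT.rep p) h) :
      lp (fun _ : ArtinMonoid Γ => ℂ) 2 ⊗[ℂ] H) : CauchySpace Γ H)

/-- The Cauchy transform `C_{r,T} h = ∑_p e_p ⊗ r^{|p|} T_p^* h`. -/
def cauchyTransform {V : Type*} {Γ : SimpleGraph V} {H : Type*} [NormedAddCommGroup H]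
    [InnerProductSpace ℂ H] [CompleteSpace H] {T : V → H →L[ℂ] H} (hT : IsGammaFamily Γ T)
    (r : ℝ) (h : H) : CauchySpace Γ H :=
  ∑' p : ArtinMonoid Γ, hT.cauchyTerm r h p

end IsGammaFamily

end

/-! Let `Φ_p(X) = T_p X T_p^*`, and let `G = ∑_p Φ_p X^{|p|}`, a power series whose coefficients
`G_n` are positive maps on `B(H)`. The subspaces `e_p ⊗ H` are orthogonal, so `‖C_{r,T} h‖² = ∑_n
r^{2n} ⟨G_n(1) h, h⟩`. It therefore suffices that `G_n(1)` is at most the coefficient of `X^n` in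
`(1 - X)^{-ω}`.

By Cartier–Foata inversion, `G` is inverse to the clique polynomial `P = ∑_U (-X)^{|U|} Φ_U`
(`cliquePoly_mul_growthSeries`). Under the full Brehmer condition the series `y_W = G(Φ_W(Z(N(W))))`
have positive coefficients. Collecting pairs `(W, U)` by `K = W ∪ U` (`sum_cliquesIn_commonNbhd`)
gives `∑_W c^{|W|} y_W = ∑_K (c - 1)^{|K|} G(Φ_K(1))`. At `c = 1` this reads `∑_W y_W = G(1)`; at `c
= 1 - X` it reads `∑_W (1 - X)^{|W|} y_W = (G P)(1) = 1`. After multiplication of the latter by `(1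
- X)^{-ω}`, each `y_W` carries the factor `(1 - X)^{-(ω - |W|)}`, which can only increase its
coefficients, so `G(1) ≤ (1 - X)^{-ω}` (`Brehmer.inner_growthSeries_le`).

Under the weak condition, `Γ` is the join of its restrictions to the components of the complement.
Hence `P` factors, its inverse factors, and the bounds multiply (`HasCliqueGrowth.union`). Cliques
of the pieces unite to a clique of `Γ`, so the total exponent is at most `ω`. -/

namespace ArtinMonoid

/-! ### Left division by generators and left cancellation. -/

variable {V : Type*} {Γ : SimpleGraph V}

theorem length_one : length (1 : ArtinMonoid Γ) = 0 := by
  simp [length]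

theorem length_gen (i : V) : length (gen Γ i) = 1 := rfl

theorem gen_commute {i j : V} (h : Γ.Adj i j) : Commute (gen Γ i) (gen Γ j) :=
  PresentedMonoid.mk_eq_mk_of_rel (ArtinRel.comm i j h)

theorem gen_induction {P : ArtinMonoid Γ → Prop} (one : P 1)
    (gen_mul : ∀ i p, P p → P (gen Γ i * p)) (p : ArtinMonoid Γ) : P p := by
  obtain ⟨l, rfl⟩ := PresentedMonoid.surjective_mk p
  induction l using FreeMonoid.inductionOn' with
  | one => exact one
  | of_mul i l ih => rw [map_mul]; exact gen_mul i _ ih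

open Classical in
/-- One step of the computation of left quotients by `e_i`. -/
noncomputable def divStep (Γ : SimpleGraph V) (i j : V) :
    Function.End (ArtinMonoid Γ × Option (ArtinMonoid Γ)) :=
  fun x => (gen Γ j * x.1,
    if j = i then some x.1 else if Γ.Adj i j then x.2.map (gen Γ j * ·) else none)

/-- This is the defining relation of the monoid, so division by `e_i` is well defined on elements
and not only on words. -/
theorem divStep_commute (i : V) {j k : V} (h : Γ.Adj j k) :
    divStep Γ i j * divStep Γ i k = divStep Γ i k * divStep Γ i j := by
  have hjk := h.ne
  have hc := (gen_commute h).eq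
  funext ⟨p, q⟩
  change divStep Γ i j (divStep Γ i k (p, q)) = divStep Γ i k (divStep Γ i j (p, q))
  simp only [divStep, Prod.mk.injEq, ← mul_assoc, hc, true_and]
  by_cases hj : j = i
  · subst hj
    simp [hjk.symm, h]
  · by_cases hk : k = i
    · subst hk
      simp [hjk, h.symm]
    · simp only [hj, hk, if_false]
      split_ifs <;> simp [Function.comp_def, ← mul_assoc, hc]

/-- The left quotient of `p` by `e_i`, if there is one. -/
noncomputable def divGen (i : V) (p : ArtinMonoid Γ) : Option (ArtinMonoid Γ) :=
  ((PresentedMonoid.lift (rels := ArtinRel Γ) (divStep Γ i) (by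
    rintro _ _ ⟨j, k, h⟩
    simpa using divStep_commute i h) p : Function.End _) (1, none)).2

/-- The first coordinate rebuilds the element itself; this is what turns the fold into a recursion
for the quotient. -/
theorem divGen_aux (i : V) (p : ArtinMonoid Γ) :
    ((PresentedMonoid.lift (rels := ArtinRel Γ) (divStep Γ i) (by
      rintro _ _ ⟨j, k, h⟩
      simpa using divStep_commute i h) p : Function.End _) (1, none)) = (p, divGen i p) := by
  refine Prod.ext ?_ rfl
  induction p using gen_induction with
  | one => rw [map_one]; rfl
  | gen_mul j p ih =>
    rw [map_mul]
    change gen Γ j * _ = _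
    rw [ih]

open Classical in
theorem divGen_gen_mul (i j : V) (p : ArtinMonoid Γ) :
    divGen i (gen Γ j * p) = if j = i then some p else
      if Γ.Adj i j then (divGen i p).map (gen Γ j * ·) else none := by
  conv_lhs => rw [divGen, map_mul]
  change (divStep Γ i j _).2 = _
  rw [divGen_aux]
  rfl

theorem divGen_one (i : V) : divGen i (1 : ArtinMonoid Γ) = none := by
  rw [divGen, map_one]; rfl

theorem gen_mul_left_cancel {i : V} {p q : ArtinMonoid Γ} (h : gen Γ i * p = gen Γ i * q) :
    p = q := by
  have := congrArg (divGen i) h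
  simpa [divGen_gen_mul] using this

theorem mul_left_cancel_of_mul_eq {a p q : ArtinMonoid Γ} (h : a * p = a * q) : p = q := by
  induction a using gen_induction with
  | one => simpa using h
  | gen_mul i a ih =>
    rw [mul_assoc, mul_assoc] at h
    exact ih (gen_mul_left_cancel h)

theorem eq_gen_mul_of_divGen {i : V} {p q : ArtinMonoid Γ} (h : divGen i p = some q) :
    p = gen Γ i * q := by
  induction p using gen_induction generalizing q with
  | one => simp [divGen_one] at h
  | gen_mul j p ih =>
    rw [divGen_gen_mul] at h
    split_ifs at h with h1 h2
    · simp only [Option.some.injEq] at h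
      rw [h, h1]
    · obtain ⟨a, ha, rfl⟩ := Option.map_eq_some_iff.1 h
      rw [ih ha, ← mul_assoc, ← mul_assoc, (gen_commute h2).eq]

/-- The recursion for the quotient of `e_j p` by `e_i` can succeed only by moving `e_j` past `e_i`.
-/
theorem gen_dvd_gen_mul {i j : V} (hij : i ≠ j) {p : ArtinMonoid Γ}
    (h : gen Γ i ∣ gen Γ j * p) : Γ.Adj i j ∧ gen Γ i ∣ p := by
  obtain ⟨q, hq⟩ := h
  have h1 : divGen i (gen Γ j * p) = some q := by rw [hq, divGen_gen_mul, if_pos rfl]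
  rw [divGen_gen_mul, if_neg hij.symm] at h1
  split_ifs at h1 with h2
  obtain ⟨a, ha, -⟩ := Option.map_eq_some_iff.1 h1
  exact ⟨h2, a, eq_gen_mul_of_divGen ha⟩

theorem finite_length_eq [Finite V] (n : ℕ) : {p : ArtinMonoid Γ | length p = n}.Finite := by
  induction n with
  | zero =>
    refine (Set.finite_singleton 1).subset fun p hp => ?_
    exact eq_one_of_length_eq_zero p hp
  | succ n ih =>
    refine (Set.Finite.image2 (fun i p => gen Γ i * p) (Set.finite_univ (α := V)) ih).subset ?_
    intro p hp
    induction p using gen_induction with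
    | one => simp [length_one] at hp
    | gen_mul i p _ =>
      refine ⟨i, trivial, p, ?_, rfl⟩
      simp only [Set.mem_ofPred_eq, length_mul, length_gen] at hp ⊢
      omega

/-- The elements of length `n`. -/
noncomputable def sphere [Finite V] (Γ : SimpleGraph V) (n : ℕ) : Finset (ArtinMonoid Γ) :=
  (finite_length_eq n).toFinset

@[simp] theorem mem_sphere [Finite V] {n : ℕ} {p : ArtinMonoid Γ} :
    p ∈ sphere Γ n ↔ length p = n := by
  simp [sphere]

end ArtinMonoid

/-! ### Products over cliques. -/

/-- The product of `f i`, `i ∈ U`, in an unspecified order. -/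
noncomputable def setProd {V M : Type*} [Monoid M] (f : V → M) (U : Finset V) : M :=
  (U.toList.map f).prod

section SetProd

variable {V M : Type*} [Monoid M] {Γ : SimpleGraph V} {f : V → M}

theorem setProd_empty : setProd f ∅ = 1 := by simp [setProd]

theorem map_setProd {N F : Type*} [Monoid N] [FunLike F M N] [MonoidHomClass F M N] (g : F)
    (U : Finset V) : g (setProd f U) = setProd (fun i => g (f i)) U := by
  simp [setProd, map_list_prod, Function.comp_def]

/-- Factors indexed by a clique commute pairwise, so the arbitrary order chosen in `setProd` is
harmless there. -/
theorem prod_map_eq_of_perm (hf : ∀ i j, Γ.Adj i j → Commute (f i) (f j)) {U : Finset V}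
    (hU : Γ.IsClique U) {l : List V} (hl : l.Perm U.toList) : (l.map f).prod = setProd f U := by
  refine (hl.map f).prod_eq' ?_
  have hnd : l.Nodup := hl.nodup_iff.2 U.nodup_toList
  rw [List.pairwise_map]
  refine hnd.imp_of_mem fun {a b} ha hb hab => hf a b (hU ?_ ?_ hab)
  · simpa using hl.mem_iff.1 ha
  · simpa using hl.mem_iff.1 hb

theorem setProd_union [DecidableEq V] (hf : ∀ i j, Γ.Adj i j → Commute (f i) (f j))
    {U W : Finset V} (h : Γ.IsClique (U ∪ W : Finset V)) (hd : Disjoint U W) :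
    setProd f (U ∪ W) = setProd f U * setProd f W := by
  rw [← prod_map_eq_of_perm hf h (l := U.toList ++ W.toList)]
  · simp [setProd]
  · refine (List.perm_ext_iff_of_nodup ?_ (Finset.nodup_toList _)).2 (by simp)
    rw [List.nodup_append']
    refine ⟨Finset.nodup_toList _, Finset.nodup_toList _, ?_⟩
    intro a ha hb
    exact Finset.disjoint_left.1 hd (by simpa using ha) (by simpa using hb)

theorem setProd_singleton (i : V) : setProd f {i} = f i := by simp [setProd]

theorem setProd_map {V' : Type*} (e : V' ↪ V) (hf : ∀ i j, Γ.Adj i j → Commute (f i) (f j))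
    {U : Finset V'} (hU : Γ.IsClique (U.map e : Finset V)) :
    setProd (fun i => f (e i)) U = setProd f (U.map e) := by
  rw [← prod_map_eq_of_perm hf hU (l := U.toList.map e)]
  · simp [setProd, Function.comp_def]
  · refine (List.perm_ext_iff_of_nodup (U.nodup_toList.map e.injective) (Finset.nodup_toList _)).2 ?_
    simp

end SetProd

/-! ### Joins of sets of generators. -/

namespace ArtinMonoid

variable {V : Type*} {Γ : SimpleGraph V}

/-- Strip off one generator `e_j` of the clique: by `gen_dvd_gen_mul`, every other `e_i` dividing
`e_j p` already divides `p`. -/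
theorem setProd_gen_dvd_iff {U : Finset V} (hU : Γ.IsClique (U : Set V)) (x : ArtinMonoid Γ) :
    setProd (gen Γ) U ∣ x ↔ ∀ i ∈ U, gen Γ i ∣ x := by
  classical
  induction U using Finset.induction_on generalizing x with
  | empty => simp [setProd_empty]
  | insert j U hj ih =>
    have hU' : Γ.IsClique (U : Set V) := hU.subset (by simp)
    have h1 : setProd (gen Γ) (insert j U) = gen Γ j * setProd (gen Γ) U := by
      rw [Finset.insert_eq, setProd_union (fun _ _ => gen_commute) (by rwa [← Finset.insert_eq])
        (by simpa using hj), setProd_singleton]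
    rw [h1]
    constructor
    · rintro ⟨y, rfl⟩ i hi
      rcases Finset.mem_insert.1 hi with rfl | hi
      · exact ⟨_, mul_assoc _ _ _⟩
      · have hij : i ≠ j := fun h => hj (h ▸ hi)
        have hadj : Γ.Adj i j := hU (by simp [hi]) (by simp) hij
        obtain ⟨z, hz⟩ := (ih hU' (setProd (gen Γ) U)).1 dvd_rfl i hi
        refine ⟨gen Γ j * z * y, ?_⟩
        rw [hz, ← mul_assoc, ← mul_assoc, ← mul_assoc, (gen_commute hadj).eq]
    · intro h
      obtain ⟨p, rfl⟩ := h j (by simp)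
      have : setProd (gen Γ) U ∣ p := (ih hU' p).2 fun i hi =>
        (gen_dvd_gen_mul (fun e => hj (by rwa [← e])) (h i (by simp [hi]))).2
      exact mul_dvd_mul_left _ this

/-- Distinct generators with a common multiple are adjacent; hence the join is `∞` off the cliques.
-/
theorem isClique_of_gen_dvd {U : Set V} {x : ArtinMonoid Γ} (h : ∀ i ∈ U, gen Γ i ∣ x) :
    Γ.IsClique U := by
  intro i hi j hj hij
  obtain ⟨p, rfl⟩ := h j hj
  exact (gen_dvd_gen_mul hij (h i hi)).1

theorem isJoin_setProd {U : Finset V} (hU : Γ.IsClique (U : Set V)) :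
    IsJoin (gen Γ '' (U : Set V)) (setProd (gen Γ) U) := fun x => by
  rw [setProd_gen_dvd_iff hU]
  simp

theorem isClique_of_isJoin {U : Set V} {r : ArtinMonoid Γ} (h : IsJoin (gen Γ '' U) r) :
    Γ.IsClique U :=
  isClique_of_gen_dvd (x := r) fun i hi => (h r).2 dvd_rfl _ ⟨i, hi, rfl⟩

theorem length_setProd_gen (U : Finset V) : length (setProd (gen Γ) U) = U.card := by
  have h : ∀ l : List V, length ((l.map (gen Γ)).prod) = l.length := by
    intro l
    induction l with
    | nil => simp [length_one]
    | cons a l ih => simp [length_mul, length_gen, ih, add_comm]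
  simp [setProd, h]

end ArtinMonoid

/-! ### The clique polynomial and its inverse, the growth series. -/

open Classical in
/-- The cliques of `Γ` contained in `S`. -/
noncomputable def cliquesIn {V : Type*} (Γ : SimpleGraph V) (S : Finset V) : Finset (Finset V) :=
  S.powerset.filter fun U => Γ.IsClique (U : Set V)

section CliquePoly

variable {V R : Type*} [Ring R] {Γ : SimpleGraph V} {f : V → R}

@[simp] theorem mem_cliquesIn {S U : Finset V} :
    U ∈ cliquesIn Γ S ↔ U ⊆ S ∧ Γ.IsClique (U : Set V) := by
  simp [cliquesIn]

/-- The clique polynomial `∑_U (-X)^{|U|} f_U` over the cliques `U ⊆ S`. -/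
noncomputable def cliquePoly (Γ : SimpleGraph V) (f : V → R) (S : Finset V) : PowerSeries R :=
  ∑ U ∈ cliquesIn Γ S, PowerSeries.X ^ U.card * PowerSeries.C ((-1) ^ U.card * setProd f U)

open PowerSeries in
theorem X_pow_mul_C_mul_X_pow_mul_C (m n : ℕ) (a b : R) :
    (X ^ m * C a) * (X ^ n * C b) = X ^ (m + n) * C (a * b) := by
  rw [mul_assoc, ← mul_assoc (C a), ← (X_pow_mul (φ := C a) (n := n)), map_mul, pow_add]
  simp only [mul_assoc]

/-- In a join, a clique is exactly a union of one clique from each side. -/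
theorem cliquePoly_union [DecidableEq V] (hf : ∀ i j, Γ.Adj i j → Commute (f i) (f j))
    {S S' : Finset V} (hd : Disjoint S S') (hj : ∀ i ∈ S, ∀ j ∈ S', Γ.Adj i j) :
    cliquePoly Γ f (S ∪ S') = cliquePoly Γ f S * cliquePoly Γ f S' := by
  unfold cliquePoly
  rw [Finset.sum_mul_sum, ← Finset.sum_product']
  symm
  refine Finset.sum_bij' (fun p _ => p.1 ∪ p.2) (fun U _ => (U ∩ S, U ∩ S')) ?_ ?_ ?_ ?_ ?_
  · rintro ⟨A, B⟩ h
    simp only [Finset.mem_product, mem_cliquesIn] at h ⊢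
    obtain ⟨⟨hA, hA'⟩, hB, hB'⟩ := h
    refine ⟨Finset.union_subset_union hA hB, ?_⟩
    intro i hi j hj' hij
    simp only [Finset.coe_union, Set.mem_union, Finset.mem_coe] at hi hj'
    rcases hi with hi | hi <;> rcases hj' with hj' | hj'
    · exact hA' hi hj' hij
    · exact hj i (hA hi) j (hB hj')
    · exact (hj j (hA hj') i (hB hi)).symm
    · exact hB' hi hj' hij
  · intro U h
    simp only [Finset.mem_product, mem_cliquesIn] at h ⊢
    exact ⟨⟨Finset.inter_subset_right, h.2.subset (by simp)⟩,
      Finset.inter_subset_right, h.2.subset (by simp)⟩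
  · rintro ⟨A, B⟩ h
    simp only [Finset.mem_product, mem_cliquesIn] at h
    have h1 := Finset.disjoint_left.1 hd
    ext i
    · have := @h.1.1 i; have := @h.2.1 i; have := @h1 i
      simp only [Finset.mem_inter, Finset.mem_union]
      tauto
    · have := @h.1.1 i; have := @h.2.1 i; have := @h1 i
      simp only [Finset.mem_inter, Finset.mem_union]
      tauto
  · intro U h
    simp only [mem_cliquesIn] at h
    rw [← Finset.inter_union_distrib_left, Finset.inter_eq_left.2 h.1]
  · rintro ⟨A, B⟩ h
    simp only [Finset.mem_product, mem_cliquesIn] at h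
    obtain ⟨⟨hA, hA'⟩, hB, hB'⟩ := h
    have hAB : Disjoint A B := Finset.disjoint_of_subset_left hA
      (Finset.disjoint_of_subset_right hB hd)
    have hcl : Γ.IsClique (A ∪ B : Finset V) := by
      intro i hi j hj' hij
      simp only [Finset.coe_union, Set.mem_union, Finset.mem_coe] at hi hj'
      rcases hi with hi | hi <;> rcases hj' with hj' | hj'
      · exact hA' hi hj' hij
      · exact hj i (hA hi) j (hB hj')
      · exact (hj j (hA hj') i (hB hi)).symm
      · exact hB' hi hj' hij
    simp only
    rw [X_pow_mul_C_mul_X_pow_mul_C, setProd_union hf hcl hAB, Finset.card_union_of_disjoint hAB,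
      pow_add (-1 : R)]
    congr 2
    rw [mul_assoc, mul_assoc, ← mul_assoc (setProd f A),
      ((Commute.neg_one_right (setProd f A)).pow_right B.card).eq, mul_assoc]

theorem cliquePoly_induce (hf : ∀ i j, Γ.Adj i j → Commute (f i) (f j)) (s : Set V) [Fintype s] :
    cliquePoly (Γ.induce s) (fun i : s => f i) Finset.univ = cliquePoly Γ f s.toFinset := by
  classical
  unfold cliquePoly
  refine Finset.sum_bij' (fun U _ => U.map (Function.Embedding.subtype _))
    (fun U _ => U.subtype (· ∈ s)) ?_ ?_ ?_ ?_ ?_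
  · intro U h
    simp only [mem_cliquesIn, Finset.subset_univ, true_and] at h ⊢
    refine ⟨fun i hi => ?_, ?_⟩
    · obtain ⟨a, -, rfl⟩ := Finset.mem_map.1 hi
      simp
    · intro i hi j hj hij
      obtain ⟨a, ha, rfl⟩ := Finset.mem_map.1 hi
      obtain ⟨b, hb, rfl⟩ := Finset.mem_map.1 hj
      exact h ha hb (fun e => hij (by rw [e]))
  · intro U h
    simp only [mem_cliquesIn, Finset.subset_univ, true_and] at h ⊢
    intro i hi j hj hij
    exact h.2 (by simpa using hi) (by simpa using hj) (fun e => hij (Subtype.ext e))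
  · intro U h
    ext i
    simp
  · intro U h
    simp only [mem_cliquesIn] at h
    ext i
    have := @h.1 i
    simp at this ⊢
    tauto
  · intro U h
    simp only [mem_cliquesIn, Finset.subset_univ, true_and] at h
    rw [Finset.card_map, ← setProd_map (Function.Embedding.subtype (· ∈ s)) hf (U := U)]
    · rfl
    · intro i hi j hj hij
      obtain ⟨a, ha, rfl⟩ := Finset.mem_map.1 hi
      obtain ⟨b, hb, rfl⟩ := Finset.mem_map.1 hj
      exact h ha hb (fun e => hij (by rw [e]))

theorem isUnit_cliquePoly (S : Finset V) : IsUnit (cliquePoly Γ f S) := by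
  classical
  rw [PowerSeries.isUnit_iff_constantCoeff]
  have h : PowerSeries.constantCoeff (cliquePoly Γ f S) = 1 := by
    unfold cliquePoly
    rw [map_sum, Finset.sum_eq_single ∅]
    · simp [setProd_empty]
    · intro U _ hU
      simp [Finset.card_ne_zero.2 (Finset.nonempty_iff_ne_empty.2 hU)]
    · simp
  rw [h]
  exact isUnit_one

open ArtinMonoid

/-- The generating series `∑_p F(p) X^{|p|}`. -/
noncomputable def growthSeries [Finite V] (F : ArtinMonoid Γ →* R) : PowerSeries R :=
  PowerSeries.mk fun n => ∑ p ∈ sphere Γ n, F p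

/-- Möbius inversion: `F q` is counted with sign `(-1)^{|U|}` for each clique `U` whose product
divides `q`. These `U` are all the subsets of `{i | e_i ∣ q}`, so the signs cancel unless that set
is empty, that is, unless `q = 1`. -/
theorem cliquePoly_mul_growthSeries [Fintype V] (F : ArtinMonoid Γ →* R) :
    cliquePoly Γ (fun i => F (gen Γ i)) Finset.univ * growthSeries F = 1 := by
  classical
  ext n
  have key : ∀ U ∈ cliquesIn Γ Finset.univ, PowerSeries.coeff n
      (PowerSeries.X ^ U.card * PowerSeries.C ((-1) ^ U.card *
        setProd (fun i => F (gen Γ i)) U) * growthSeries F) =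
      ∑ q ∈ sphere Γ n, if setProd (gen Γ) U ∣ q then ((-1 : ℤ) ^ U.card) • F q else 0 := by
    intro U hU
    rw [mul_assoc, PowerSeries.coeff_X_pow_mul', ← map_setProd F, ← Finset.sum_filter]
    split_ifs with h
    · rw [PowerSeries.coeff_C_mul, growthSeries, PowerSeries.coeff_mk, Finset.mul_sum]
      -- Left cancellation makes `p ↦ e_U p` a bijection onto the multiples of `e_U` of length `n`.
      refine Finset.sum_bij (fun p _ => setProd (gen Γ) U * p) ?_ ?_ ?_ ?_
      · intro p hp
        simp only [mem_sphere, Finset.mem_filter, length_mul, length_setProd_gen] at hp ⊢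
        exact ⟨by omega, dvd_mul_right _ _⟩
      · intro p _ q _ hpq
        exact mul_left_cancel_of_mul_eq hpq
      · intro q hq
        simp only [mem_sphere, Finset.mem_filter] at hq
        obtain ⟨hq, p, rfl⟩ := hq
        refine ⟨p, ?_, rfl⟩
        simp only [mem_sphere, length_mul, length_setProd_gen] at hq ⊢
        omega
      · intro p _
        rw [map_mul, mul_assoc]
        simp
    · symm
      refine Finset.sum_eq_zero fun q hq => ?_
      simp only [mem_sphere, Finset.mem_filter] at hq
      obtain ⟨hq, p, rfl⟩ := hq
      simp only [length_mul, length_setProd_gen] at hq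
      omega
  rw [cliquePoly, Finset.sum_mul, map_sum, Finset.sum_congr rfl key, Finset.sum_comm]
  have inner : ∀ q : ArtinMonoid Γ, (∑ U ∈ cliquesIn Γ Finset.univ,
      if setProd (gen Γ) U ∣ q then ((-1 : ℤ) ^ U.card) • F q else 0) =
      if q = 1 then 1 else 0 := by
    intro q
    have hset : (cliquesIn Γ Finset.univ).filter (fun U => setProd (gen Γ) U ∣ q) =
        (Finset.univ.filter fun i => gen Γ i ∣ q).powerset := by
      ext U
      simp only [Finset.mem_filter, mem_cliquesIn, Finset.subset_univ, true_and,
        Finset.mem_powerset]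
      constructor
      · rintro ⟨h1, h2⟩ i hi
        simpa using (setProd_gen_dvd_iff h1 q).1 h2 i hi
      · intro h
        have h' : ∀ i ∈ U, gen Γ i ∣ q := fun i hi => by simpa using h hi
        have hc : Γ.IsClique (U : Set V) := isClique_of_gen_dvd h'
        exact ⟨hc, (setProd_gen_dvd_iff hc q).2 h'⟩
    rw [← Finset.sum_filter, hset, ← Finset.sum_smul, Finset.sum_powerset_neg_one_pow_card]
    have hq : (Finset.univ.filter fun i => gen Γ i ∣ q) = ∅ ↔ q = 1 := by
      rw [Finset.filter_eq_empty_iff]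
      constructor
      · intro h
        induction q using gen_induction with
        | one => rfl
        | gen_mul i p _ => exact absurd (dvd_mul_right _ _) (h (Finset.mem_univ i))
      · rintro rfl i _ ⟨p, hp⟩
        have := congrArg length hp
        simp [length_mul, length_gen, length_one] at this
        omega
    simp only [hq]
    split_ifs with h
    · simp [h]
    · simp
  rw [Finset.sum_congr rfl fun q _ => inner q, Finset.sum_ite_eq']
  rw [PowerSeries.coeff_one]
  simp [length_one, eq_comm]

/-- The clique polynomial has constant term `1`, hence is a unit, and its right inverse is two-sided
even over a noncommutative ring. -/
theorem growthSeries_mul_cliquePoly [Fintype V] (F : ArtinMonoid Γ →* R) :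
    growthSeries F * cliquePoly Γ (fun i => F (gen Γ i)) Finset.univ = 1 := by
  obtain ⟨u, hu⟩ := isUnit_cliquePoly (Γ := Γ) (f := fun i => F (gen Γ i)) Finset.univ
  have h := cliquePoly_mul_growthSeries F
  rw [← hu] at h ⊢
  rw [← Units.inv_eq_of_mul_eq_one_right h, Units.inv_mul]

end CliquePoly

/-! ### Coefficients of `(1 - X)^{-k}` and the resummation identity. -/

/-- The coefficient of `X^n` in `(1 - X)^{-k}`. -/
noncomputable def negBinom (k n : ℕ) : ℝ :=
  PowerSeries.coeff n (PowerSeries.invOneSubPow ℝ k : PowerSeries ℝ)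

theorem negBinom_zero (n : ℕ) : negBinom 0 n = if n = 0 then 1 else 0 := by
  simp [negBinom, PowerSeries.invOneSubPow_zero, PowerSeries.coeff_one]

theorem negBinom_succ (k n : ℕ) : negBinom (k + 1) n = ((k + n).choose k : ℝ) := by
  simp [negBinom, PowerSeries.invOneSubPow_val_succ_eq_mk_add_choose]

theorem negBinom_nonneg (k n : ℕ) : 0 ≤ negBinom k n := by
  cases k with
  | zero => rw [negBinom_zero]; positivity
  | succ k => rw [negBinom_succ]; positivity

theorem negBinom_zero_right (k : ℕ) : negBinom k 0 = 1 := by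
  cases k with
  | zero => simp [negBinom_zero]
  | succ k => simp [negBinom_succ]

theorem negBinom_add (k l n : ℕ) :
    negBinom (k + l) n = ∑ p ∈ Finset.HasAntidiagonal.antidiagonal n, negBinom k p.1 * negBinom l p.2 := by
  simp only [negBinom, PowerSeries.invOneSubPow_add, Units.val_mul, PowerSeries.coeff_mul]

theorem negBinom_mono {k l : ℕ} (h : k ≤ l) (n : ℕ) : negBinom k n ≤ negBinom l n := by
  obtain ⟨m, rfl⟩ := Nat.exists_eq_add_of_le h
  rw [negBinom_add]
  have := Finset.single_le_sum (f := fun p : ℕ × ℕ => negBinom k p.1 * negBinom m p.2)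
    (s := Finset.HasAntidiagonal.antidiagonal n) (fun p _ => mul_nonneg (negBinom_nonneg _ _) (negBinom_nonneg _ _))
    (a := (n, 0)) (by simp)
  simpa [negBinom_zero_right] using this

/-- `(1 - X)^{-k}` has constant term `1` and nonnegative coefficients. -/
theorem le_coeff_invOneSubPow_mul (k n : ℕ) (f : PowerSeries ℝ)
    (hf : ∀ m, 0 ≤ PowerSeries.coeff m f) :
    PowerSeries.coeff n f ≤
      PowerSeries.coeff n ((PowerSeries.invOneSubPow ℝ k : PowerSeries ℝ) * f) := by
  rw [PowerSeries.coeff_mul]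
  have := Finset.single_le_sum (f := fun p : ℕ × ℕ => negBinom k p.1 * PowerSeries.coeff p.2 f)
    (s := Finset.HasAntidiagonal.antidiagonal n) (fun p _ => mul_nonneg (negBinom_nonneg _ _) (hf _))
    (a := (0, n)) (by simp)
  simp only [negBinom_zero_right, one_mul] at this
  exact this

theorem hasSum_negBinom (k : ℕ) {x : ℝ} (h0 : 0 ≤ x) (h1 : x < 1) :
    HasSum (fun n => negBinom k n * x ^ n) (1 / (1 - x) ^ k) := by
  cases k with
  | zero =>
    simp only [negBinom_zero, pow_zero, div_one]
    convert! hasSum_ite_eq 0 (1 : ℝ) using 2 with n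
    split_ifs with h <;> simp [h]
  | succ k =>
    have := hasSum_choose_mul_geometric_of_norm_lt_one k (r := x)
      (by rwa [Real.norm_of_nonneg h0])
    simpa [negBinom_succ, add_comm] using this

/-- A pair of a clique `W` and a clique `U ⊆ N(W)` is the same as a clique `K = W ∪ U` with a marked
subset `W`. The binomial theorem then sums over `W ⊆ K`. -/
theorem sum_cliquesIn_commonNbhd {V R : Type*} [Fintype V] [DecidableEq V] [CommRing R]
    (Γ : SimpleGraph V)
    (g : Finset V → R) (c : R) :
    ∑ W ∈ cliquesIn Γ Finset.univ, c ^ W.card *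
      ∑ U ∈ cliquesIn Γ (commonNbhd Γ W), (-1) ^ U.card * g (W ∪ U) =
    ∑ K ∈ cliquesIn Γ Finset.univ, (c - 1) ^ K.card * g K := by
  have h : ∀ K : Finset V, (c - 1) ^ K.card * g K =
      ∑ W ∈ K.powerset, c ^ W.card * (-1) ^ (K.card - W.card) * g K := by
    intro K
    rw [sub_eq_add_neg, ← Finset.sum_pow_mul_eq_add_pow, Finset.sum_mul]
  simp only [h, Finset.mul_sum]
  rw [Finset.sum_sigma', Finset.sum_sigma']
  have hN : ∀ (W : Finset V) (i : V), i ∈ commonNbhd Γ W ↔ ∀ j ∈ W, Γ.Adj i j := by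
    simp [commonNbhd]
  refine Finset.sum_bij' (fun p _ => ⟨p.1 ∪ p.2, p.1⟩) (fun p _ => ⟨p.2, p.1 \ p.2⟩) ?_ ?_ ?_ ?_ ?_
  · rintro ⟨W, U⟩ h
    simp only [Finset.mem_sigma, mem_cliquesIn, Finset.subset_univ, true_and,
      Finset.mem_powerset] at h ⊢
    obtain ⟨hW, hU, hU'⟩ := h
    refine ⟨?_, Finset.subset_union_left⟩
    intro i hi j hj hij
    simp only [Finset.coe_union, Set.mem_union, Finset.mem_coe] at hi hj
    rcases hi with hi | hi <;> rcases hj with hj | hj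
    · exact hW hi hj hij
    · exact ((hN _ _).1 (hU hj) i hi).symm
    · exact (hN _ _).1 (hU hi) j hj
    · exact hU' hi hj hij
  · rintro ⟨K, W⟩ h
    simp only [Finset.mem_sigma, mem_cliquesIn, Finset.subset_univ, true_and,
      Finset.mem_powerset] at h ⊢
    obtain ⟨hK, hW⟩ := h
    refine ⟨hK.subset (by simpa using hW), fun i hi => ?_, hK.subset (by simp)⟩
    rw [hN]
    intro j hj
    simp only [Finset.mem_sdiff] at hi
    exact hK hi.1 (hW hj) (fun e => hi.2 (by rwa [e]))
  · rintro ⟨W, U⟩ h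
    simp only [Finset.mem_sigma, mem_cliquesIn] at h
    have hd : Disjoint W U := Finset.disjoint_left.2 fun i hi hi' =>
      Γ.loopless.irrefl i ((hN _ _).1 (h.2.1 hi') i hi)
    simp [Finset.union_sdiff_cancel_left hd]
  · rintro ⟨K, W⟩ h
    simp only [Finset.mem_sigma, Finset.mem_powerset] at h
    simp [Finset.union_sdiff_of_subset h.2]
  · rintro ⟨W, U⟩ h
    simp only [Finset.mem_sigma, mem_cliquesIn] at h
    have hd : Disjoint W U := Finset.disjoint_left.2 fun i hi hi' =>
      Γ.loopless.irrefl i ((hN _ _).1 (h.2.1 hi') i hi)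
    simp only [Finset.card_union_of_disjoint hd, Nat.add_sub_cancel_left, mul_assoc]

/-! ### Positive maps on `B(H)` and their scalar series. -/

section Conj

variable {H : Type*} [NormedAddCommGroup H] [InnerProductSpace ℂ H]

/-- `A ↦ (X ↦ A X A^*)`. -/
noncomputable def conjHom (H : Type*) [NormedAddCommGroup H] [InnerProductSpace ℂ H]
    [CompleteSpace H] : (H →L[ℂ] H) →* Module.End ℂ (H →L[ℂ] H) where
  toFun A := LinearMap.mulLeft ℂ A ∘ₗ LinearMap.mulRight ℂ (ContinuousLinearMap.adjoint A)
  map_one' := by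
    ext1 X
    simp [← ContinuousLinearMap.star_eq_adjoint]
  map_mul' A B := by
    ext1 X
    simp [← ContinuousLinearMap.star_eq_adjoint, mul_assoc]

theorem conjHom_apply [CompleteSpace H] (A X : H →L[ℂ] H) :
    conjHom H A X = A * (X * ContinuousLinearMap.adjoint A) := rfl

/-- A linear map on `B(H)` that preserves positivity. -/
def IsPositiveMap (Φ : Module.End ℂ (H →L[ℂ] H)) : Prop :=
  ∀ X : H →L[ℂ] H, X.IsPositive → (Φ X).IsPositive

theorem isPositiveMap_conjHom [CompleteSpace H] (A : H →L[ℂ] H) : IsPositiveMap (conjHom H A) := fun X hX => by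
  rw [conjHom_apply]
  exact hX.conj_adjoint A

theorem IsPositiveMap.mul {Φ Ψ : Module.End ℂ (H →L[ℂ] H)} (hΦ : IsPositiveMap Φ)
    (hΨ : IsPositiveMap Ψ) : IsPositiveMap (Φ * Ψ) := fun X hX => hΦ _ (hΨ X hX)

theorem ContinuousLinearMap.IsPositive.finset_sum {ι : Type*} {s : Finset ι}
    {f : ι → H →L[ℂ] H} (hf : ∀ i ∈ s, (f i).IsPositive) : (∑ i ∈ s, f i).IsPositive := by
  classical
  induction s using Finset.induction_on with
  | empty => simp
  | insert i s hi ih =>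
    rw [Finset.sum_insert hi]
    exact (hf i (by simp)).add (ih fun j hj => hf j (by simp [hj]))

theorem IsPositiveMap.sum {ι : Type*} {s : Finset ι} {Φ : ι → Module.End ℂ (H →L[ℂ] H)}
    (h : ∀ i ∈ s, IsPositiveMap (Φ i)) : IsPositiveMap (∑ i ∈ s, Φ i) := fun X hX => by
  rw [LinearMap.sum_apply]
  exact ContinuousLinearMap.IsPositive.finset_sum fun i hi => h i hi X hX

/-- The scalar series `∑_n ⟨G_n(Y) h, h⟩ X^n`. -/
noncomputable def vectorSeries (h : H) (G : PowerSeries (Module.End ℂ (H →L[ℂ] H))) :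
    (H →L[ℂ] H) →+ PowerSeries ℝ where
  toFun Y := PowerSeries.mk fun n => (inner ℂ (PowerSeries.coeff n G Y h) h).re
  map_zero' := by ext; simp
  map_add' Y Z := by ext; simp

theorem coeff_vectorSeries (h : H) (G : PowerSeries (Module.End ℂ (H →L[ℂ] H)))
    (Y : H →L[ℂ] H) (n : ℕ) : PowerSeries.coeff n (vectorSeries h G Y) =
      (inner ℂ (PowerSeries.coeff n G Y h) h).re := by
  simp [vectorSeries]

theorem vectorSeries_sum {ι : Type*} (h : H) (s : Finset ι)
    (G : ι → PowerSeries (Module.End ℂ (H →L[ℂ] H))) (Y : H →L[ℂ] H) :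
    vectorSeries h (∑ i ∈ s, G i) Y = ∑ i ∈ s, vectorSeries h (G i) Y := by
  ext n
  simp [coeff_vectorSeries, LinearMap.sum_apply]

theorem vectorSeries_mul_monomial (h : H) (G : PowerSeries (Module.End ℂ (H →L[ℂ] H))) (k : ℕ)
    (a : Module.End ℂ (H →L[ℂ] H)) (Y : H →L[ℂ] H) :
    vectorSeries h (G * (PowerSeries.X ^ k * PowerSeries.C a)) Y =
      PowerSeries.X ^ k * vectorSeries h G (a Y) := by
  ext n
  rw [PowerSeries.X_pow_mul, ← mul_assoc, coeff_vectorSeries, PowerSeries.coeff_mul_X_pow',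
    PowerSeries.coeff_X_pow_mul']
  split_ifs
  · rw [PowerSeries.coeff_mul_C, coeff_vectorSeries]
    rfl
  · simp

theorem vectorSeries_smul (h : H) (G : PowerSeries (Module.End ℂ (H →L[ℂ] H))) (k : ℕ)
    (Y : H →L[ℂ] H) :
    vectorSeries h G ((-1 : ℂ) ^ k • Y) = (-1) ^ k * vectorSeries h G Y := by
  rcases neg_one_pow_eq_or ℂ k with hk | hk <;> rcases Nat.even_or_odd k with hk' | hk' <;>
    simp [hk'.neg_one_pow]

theorem neg_one_pow_mul_apply (k : ℕ) (a : Module.End ℂ (H →L[ℂ] H)) (X : H →L[ℂ] H) :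
    ((-1) ^ k * a) X = (-1 : ℂ) ^ k • a X := by
  induction k with
  | zero => simp
  | succ k ih =>
    rw [pow_succ', mul_assoc, pow_succ', neg_one_mul, neg_smul, ← ih]
    rfl

theorem vectorSeries_one (h : H) :
    vectorSeries h 1 1 = PowerSeries.C (‖h‖ ^ 2) := by
  ext n
  rw [coeff_vectorSeries, PowerSeries.coeff_one, PowerSeries.coeff_C]
  split_ifs
  · simp [← Complex.ofReal_pow]
  · simp

end Conj

/-! ### The growth bound under the full Brehmer condition. -/

namespace IsGammaFamily

open ArtinMonoid

variable {V : Type*} {Γ : SimpleGraph V} {H : Type*} [NormedAddCommGroup H]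
  [InnerProductSpace ℂ H] {T : V → H →L[ℂ] H} (hT : IsGammaFamily Γ T)

theorem rep_setProd (U : Finset V) : hT.rep (setProd (gen Γ) U) = setProd T U := by
  rw [map_setProd]
  rfl

variable [CompleteSpace H]

/-- The action `X ↦ T_p X T_p^*` of the Artin monoid on `B(H)`. -/
noncomputable def conjRep : ArtinMonoid Γ →* Module.End ℂ (H →L[ℂ] H) :=
  (conjHom H).comp hT.rep

include hT in
theorem conjHom_commute (i j : V) (h : Γ.Adj i j) : Commute (conjHom H (T i)) (conjHom H (T j)) :=
  (hT.commute i j h).map (conjHom H)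

/-- Sets that are not cliques have join `∞` and contribute zero. -/
theorem brehmerZ_eq (A : Finset V) : hT.brehmerZ A =
    ∑ U ∈ cliquesIn Γ A, (-1 : ℂ) ^ U.card • setProd (fun i => conjHom H (T i)) U 1 := by
  classical
  rw [brehmerZ, cliquesIn, Finset.sum_filter]
  refine Finset.sum_congr rfl fun U _ => ?_
  split_ifs with hU
  · rw [hT.repJoin_eq (isJoin_setProd hU), rep_setProd, ← map_setProd, conjHom_apply, one_mul]
  · have : hT.repJoin (gen Γ '' (U : Set V)) = 0 := by
      rw [repJoin, dif_neg]
      rintro ⟨r, hr⟩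
      exact hU (isClique_of_isJoin hr)
    simp [this]

theorem isPositiveMap_coeff_growthSeries [Finite V] (n : ℕ) :
    IsPositiveMap (PowerSeries.coeff n (growthSeries hT.conjRep)) := by
  rw [growthSeries, PowerSeries.coeff_mk]
  exact IsPositiveMap.sum fun p _ => isPositiveMap_conjHom _

theorem Brehmer.inner_growthSeries_le [Finite V] {hT : IsGammaFamily Γ T} (hB : hT.Brehmer)
    (n : ℕ) (h : H) :
    (inner ℂ (PowerSeries.coeff n (growthSeries hT.conjRep) 1 h) h).re ≤
      negBinom Γ.cliqueNum n * ‖h‖ ^ 2 := by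
  classical
  cases nonempty_fintype V
  set G := growthSeries hT.conjRep with hG
  set g : Finset V → PowerSeries ℝ := fun K =>
    vectorSeries h G (setProd (fun i => conjHom H (T i)) K 1) with hg
  set y : Finset V → PowerSeries ℝ := fun W =>
    ∑ U ∈ cliquesIn Γ (commonNbhd Γ W), (-1) ^ U.card * g (W ∪ U) with hy
  -- For `U ⊆ N(W)` the map `Φ_{W ∪ U}` is `Φ_W Φ_U`, so `Φ_W` factors out of the alternating sum
  -- and leaves `Z(N(W))`.
  have hyW : ∀ W ∈ cliquesIn Γ Finset.univ, y W = vectorSeries h G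
      (setProd (fun i => conjHom H (T i)) W (hT.brehmerZ (commonNbhd Γ W))) := by
    intro W hW
    rw [hT.brehmerZ_eq, map_sum, map_sum]
    refine Finset.sum_congr rfl fun U hU => ?_
    simp only [mem_cliquesIn, Finset.subset_univ, true_and] at hU hW
    have hN : ∀ i ∈ U, ∀ j ∈ W, Γ.Adj i j := fun i hi => by
      simpa [commonNbhd] using hU.1 hi
    rw [map_smul, vectorSeries_smul]
    simp only [hg]
    rw [setProd_union hT.conjHom_commute]
    · rfl
    · intro i hi j hj hij
      simp only [Finset.coe_union, Set.mem_union, Finset.mem_coe] at hi hj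
      rcases hi with hi | hi <;> rcases hj with hj | hj
      · exact hW hi hj hij
      · exact (hN j hj i hi).symm
      · exact hN i hi j hj
      · exact hU.2 hi hj hij
    · exact Finset.disjoint_left.2 fun i hi hi' => Γ.loopless.irrefl i (hN i hi' i hi)
  have hypos : ∀ W ∈ cliquesIn Γ Finset.univ, ∀ m, 0 ≤ PowerSeries.coeff m (y W) := by
    intro W hW m
    rw [hyW W hW, coeff_vectorSeries]
    have hZ := hB W (by simpa using hW)
    have h1 : (setProd (fun i => conjHom H (T i)) W
        (hT.brehmerZ (commonNbhd Γ W))).IsPositive := by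
      rw [← map_setProd]
      exact isPositiveMap_conjHom _ _ hZ
    exact (hT.isPositiveMap_coeff_growthSeries m _ h1).re_inner_nonneg_left h
  -- The case `c = 1`: the powers of `c - 1 = 0` kill every clique but the empty one.
  have hsum1 : ∑ W ∈ cliquesIn Γ Finset.univ, y W = vectorSeries h G 1 := by
    have := sum_cliquesIn_commonNbhd Γ g 1
    simp only [one_pow, one_mul, sub_self] at this
    rw [this, Finset.sum_eq_single ∅]
    · simp [hg, setProd_empty]
    · intro U _ hU
      rw [zero_pow (Finset.card_ne_zero.2 (Finset.nonempty_iff_ne_empty.2 hU)), zero_mul]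
    · simp
  -- The case `c = 1 - X`: the weights `(-X)^{|K|}` reassemble the clique polynomial, which cancels
  -- `G`.
  have hsum2 : ∑ W ∈ cliquesIn Γ Finset.univ, (1 - PowerSeries.X) ^ W.card * y W =
      PowerSeries.C (‖h‖ ^ 2) := by
    rw [sum_cliquesIn_commonNbhd Γ g (1 - PowerSeries.X), ← vectorSeries_one,
      ← growthSeries_mul_cliquePoly hT.conjRep, cliquePoly, Finset.mul_sum, vectorSeries_sum]
    refine Finset.sum_congr rfl fun K _ => ?_
    rw [vectorSeries_mul_monomial]
    have : ((-1) ^ K.card * setProd (fun i => hT.conjRep (gen Γ i)) K :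
        Module.End ℂ (H →L[ℂ] H)) 1 =
        (-1 : ℂ) ^ K.card • setProd (fun i => conjHom H (T i)) K 1 := by
      exact neg_one_pow_mul_apply _ _ _
    rw [this, vectorSeries_smul, ← mul_assoc, ← mul_pow]
    simp [hg, hG]
  have hmul : ∑ W ∈ cliquesIn Γ Finset.univ,
      (PowerSeries.invOneSubPow ℝ (Γ.cliqueNum - W.card) : PowerSeries ℝ) * y W =
      (PowerSeries.invOneSubPow ℝ Γ.cliqueNum : PowerSeries ℝ) * PowerSeries.C (‖h‖ ^ 2) := by
    rw [← hsum2, Finset.mul_sum]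
    refine Finset.sum_congr rfl fun W hW => ?_
    have hle : W.card ≤ Γ.cliqueNum :=
      SimpleGraph.IsClique.card_le_cliqueNum (tc := (mem_cliquesIn.1 hW).2)
    rw [← PowerSeries.one_sub_pow_mul_invOneSubPow_val_add_eq_invOneSubPow_val ℝ
      (Γ.cliqueNum - W.card) W.card, Nat.sub_add_cancel hle]
    ring
  have hfin := congrArg (PowerSeries.coeff n) hmul
  rw [map_sum, PowerSeries.coeff_mul_C] at hfin
  rw [← coeff_vectorSeries, ← hsum1, map_sum]
  refine le_trans (Finset.sum_le_sum fun W hW => le_coeff_invOneSubPow_mul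
    (Γ.cliqueNum - W.card) n (y W) (hypos W hW)) hfin.le

end IsGammaFamily

/-! ### From the components of the complement to the whole graph. -/

section Growth

theorem re_inner_smul_one_sub_apply {H : Type*} [NormedAddCommGroup H] [InnerProductSpace ℂ H]
    (c : ℝ) (Y : H →L[ℂ] H) (x : H) :
    (inner ℂ (((c : ℂ) • (1 : H →L[ℂ] H) - Y) x) x).re = c * ‖x‖ ^ 2 - (inner ℂ (Y x) x).re := by
  have h : ((c : ℂ) • (1 : H →L[ℂ] H) - Y) x = (c : ℂ) • x - Y x := rfl
  rw [h, inner_sub_left, inner_smul_left, inner_self_eq_norm_sq_to_K, Complex.sub_re]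
  simp [← Complex.ofReal_pow]

variable {V : Type*} {Γ : SimpleGraph V} {H : Type*} [NormedAddCommGroup H]
  [InnerProductSpace ℂ H] [CompleteSpace H] {T : V → H →L[ℂ] H}

/-- The clique polynomial of `S` has an inverse with positive coefficients `G_n` such that
`∑ G_n(1) X^n` is dominated by `(1 - X)^{-|K|}` for some clique `K ⊆ S`. -/
def HasCliqueGrowth (Γ : SimpleGraph V) (T : V → H →L[ℂ] H) (S : Finset V) : Prop :=
  ∃ (K : Finset V) (G : PowerSeries (Module.End ℂ (H →L[ℂ] H))),
    K ⊆ S ∧ Γ.IsClique (K : Set V) ∧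
    cliquePoly Γ (fun i => conjHom H (T i)) S * G = 1 ∧
    (∀ n, IsPositiveMap (PowerSeries.coeff n G)) ∧
    ∀ n, ((negBinom K.card n : ℂ) • (1 : H →L[ℂ] H) - PowerSeries.coeff n G 1).IsPositive

theorem HasCliqueGrowth.empty : HasCliqueGrowth Γ T ∅ := by
  refine ⟨∅, 1, subset_rfl, by simp, ?_, fun n => ?_, fun n => ?_⟩
  · have : cliquesIn Γ ∅ = {∅} := by
      ext U
      simp only [mem_cliquesIn, Finset.subset_empty, Finset.mem_singleton]
      exact ⟨fun h => h.1, fun h => ⟨h, by simp [h]⟩⟩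
    simp [cliquePoly, this, setProd_empty]
  · rw [PowerSeries.coeff_one]
    split_ifs
    · exact fun X hX => hX
    · exact fun X _ => ContinuousLinearMap.isPositive_zero
  · rw [PowerSeries.coeff_one, Finset.card_empty, negBinom_zero]
    split_ifs <;> simp

/-- The inverses multiply in reverse order. Positivity of `G'` lets the bound on `G(1)` be fed
through `G'` before the bound on `G'(1)` is applied. -/
theorem HasCliqueGrowth.union [DecidableEq V] (hT : IsGammaFamily Γ T) {S S' : Finset V}
    (h : HasCliqueGrowth Γ T S) (h' : HasCliqueGrowth Γ T S')
    (hd : Disjoint S S') (hj : ∀ i ∈ S, ∀ j ∈ S', Γ.Adj i j) :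
    HasCliqueGrowth Γ T (S ∪ S') := by
  obtain ⟨K, G, hKS, hK, hG, hpos, hle⟩ := h
  obtain ⟨K', G', hKS', hK', hG', hpos', hle'⟩ := h'
  have hdK : Disjoint K K' := Finset.disjoint_of_subset_left hKS
    (Finset.disjoint_of_subset_right hKS' hd)
  refine ⟨K ∪ K', G' * G, Finset.union_subset_union hKS hKS', ?_, ?_, fun n => ?_, fun n => ?_⟩
  · intro i hi j hj' hij
    simp only [Finset.coe_union, Set.mem_union, Finset.mem_coe] at hi hj'
    rcases hi with hi | hi <;> rcases hj' with hj' | hj'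
    · exact hK hi hj' hij
    · exact hj i (hKS hi) j (hKS' hj')
    · exact (hj j (hKS hj') i (hKS' hi)).symm
    · exact hK' hi hj' hij
  · rw [cliquePoly_union hT.conjHom_commute hd hj, mul_assoc, ← mul_assoc _ G', hG', one_mul, hG]
  · rw [PowerSeries.coeff_mul]
    exact IsPositiveMap.sum fun p _ => (hpos' _).mul (hpos _)
  · rw [Finset.card_union_of_disjoint hdK, add_comm, negBinom_add, PowerSeries.coeff_mul,
      LinearMap.sum_apply, Complex.ofReal_sum, Finset.sum_smul, ← Finset.sum_sub_distrib]
    refine ContinuousLinearMap.IsPositive.finset_sum fun p _ => ?_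
    have e1 := hpos' p.1 _ (hle p.2)
    have e2 := (hle' p.1).smul_of_nonneg
      (c := (negBinom K.card p.2 : ℂ)) (by exact_mod_cast negBinom_nonneg _ _)
    -- With `a`, `b` the two scalar bounds, `ab - G'(G(1)) = a (b - G'(1)) + G'(a - G(1))`.
    convert! e2.add e1 using 1
    rw [map_sub, map_smul, smul_sub, smul_smul, Module.End.mul_apply, sub_add_sub_cancel,
      Complex.ofReal_mul, mul_comm]

theorem IsGammaFamily.Brehmer.growthSeries_le [Finite V] {hT : IsGammaFamily Γ T}
    (hB : hT.Brehmer) (n : ℕ) : ((negBinom Γ.cliqueNum n : ℂ) • (1 : H →L[ℂ] H) -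
      PowerSeries.coeff n (growthSeries hT.conjRep) 1).IsPositive := by
  have h1 : (PowerSeries.coeff n (growthSeries hT.conjRep) 1).IsPositive :=
    hT.isPositiveMap_coeff_growthSeries n _ ContinuousLinearMap.isPositive_one
  have h2 : ((negBinom Γ.cliqueNum n : ℂ) • (1 : H →L[ℂ] H)).IsPositive :=
    ContinuousLinearMap.isPositive_one.smul_of_nonneg (by exact_mod_cast negBinom_nonneg _ _)
  rw [ContinuousLinearMap.isPositive_def']
  refine ⟨h2.isSelfAdjoint.sub h1.isSelfAdjoint, fun x => ?_⟩
  have := hB.inner_growthSeries_le n x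
  rw [ContinuousLinearMap.reApplyInnerSelf_apply]
  refine le_of_le_of_eq (sub_nonneg.2 this) ?_
  exact (re_inner_smul_one_sub_apply _ _ _).symm

theorem IsGammaFamily.hasCliqueGrowth_of_brehmer_restrict [Finite V] (hT : IsGammaFamily Γ T)
    (s : Set V) [Fintype s] (hB : (hT.restrict s).Brehmer) :
    HasCliqueGrowth Γ T s.toFinset := by
  obtain ⟨K, hK⟩ := (Γ.induce s).exists_isNClique_cliqueNum
  refine ⟨K.map (Function.Embedding.subtype _), growthSeries (hT.restrict s).conjRep,
    fun i hi => ?_, ?_, ?_, (hT.restrict s).isPositiveMap_coeff_growthSeries, ?_⟩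
  · obtain ⟨a, -, rfl⟩ := Finset.mem_map.1 hi
    simp
  · intro i hi j hj hij
    obtain ⟨a, ha, rfl⟩ := Finset.mem_map.1 hi
    obtain ⟨b, hb, rfl⟩ := Finset.mem_map.1 hj
    exact hK.isClique ha hb (fun e => hij (by rw [e]))
  · rw [← cliquePoly_induce hT.conjHom_commute]
    exact cliquePoly_mul_growthSeries (hT.restrict s).conjRep
  · rw [Finset.card_map, hK.card_eq]
    exact hB.growthSeries_le

/-- Vertices in different components of the complement are adjacent in `Γ`, so the components can be
joined one at a time. -/
theorem IsGammaFamily.WeakBrehmer.hasCliqueGrowth [Fintype V] {hT : IsGammaFamily Γ T}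
    (hB : hT.WeakBrehmer) : HasCliqueGrowth Γ T Finset.univ := by
  classical
  have key : ∀ 𝒞 : Finset Γᶜ.ConnectedComponent, HasCliqueGrowth Γ T
      (Finset.univ.filter fun i => Γᶜ.connectedComponentMk i ∈ 𝒞) := by
    intro 𝒞
    induction 𝒞 using Finset.induction_on with
    | empty => simpa using HasCliqueGrowth.empty
    | insert C 𝒞 hC ih =>
      have e : (Finset.univ.filter fun i => Γᶜ.connectedComponentMk i ∈ insert C 𝒞) =
          C.supp.toFinset ∪ Finset.univ.filter fun i => Γᶜ.connectedComponentMk i ∈ 𝒞 := by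
        ext i
        simp
      rw [e]
      refine (hT.hasCliqueGrowth_of_brehmer_restrict C.supp (hB C)).union hT ih ?_ ?_
      · rw [Finset.disjoint_left]
        intro i hi hi'
        simp only [Set.mem_toFinset, SimpleGraph.ConnectedComponent.mem_supp_iff,
          Finset.mem_filter, Finset.mem_univ, true_and] at hi hi'
        exact hC (hi ▸ hi')
      · intro i hi j hj
        simp only [Set.mem_toFinset, SimpleGraph.ConnectedComponent.mem_supp_iff,
          Finset.mem_filter, Finset.mem_univ, true_and] at hi hj
        have hne : Γᶜ.connectedComponentMk i ≠ Γᶜ.connectedComponentMk j := fun h =>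
          hC (by rwa [← hi, h])
        by_contra hadj
        refine hne (SimpleGraph.ConnectedComponent.connectedComponentMk_eq_of_adj ?_)
        rw [SimpleGraph.compl_adj]
        exact ⟨fun h => hne (by rw [h]), hadj⟩
  simpa using key Finset.univ

open ArtinMonoid in
theorem IsGammaFamily.WeakBrehmer.sum_sphere_le [Finite V] {hT : IsGammaFamily Γ T}
    (hB : hT.WeakBrehmer) (n : ℕ) (h : H) :
    ∑ p ∈ sphere Γ n, ‖ContinuousLinearMap.adjoint (hT.rep p) h‖ ^ 2 ≤
      negBinom Γ.cliqueNum n * ‖h‖ ^ 2 := by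
  cases nonempty_fintype V
  obtain ⟨K, G, -, hK, hG, -, hle⟩ := hB.hasCliqueGrowth
  -- Uniqueness of inverses identifies the product of the component series with the growth series of
  -- `Γ`.
  have hG' : growthSeries hT.conjRep = G :=
    left_inv_eq_right_inv (growthSeries_mul_cliquePoly hT.conjRep) hG
  have h1 := le_of_le_of_eq ((hle n).re_inner_nonneg_left h) (re_inner_smul_one_sub_apply _ _ _)
  have h2 : (inner ℂ (PowerSeries.coeff n G 1 h) h).re =
      ∑ p ∈ sphere Γ n, ‖ContinuousLinearMap.adjoint (hT.rep p) h‖ ^ 2 := by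
    rw [← hG', growthSeries, PowerSeries.coeff_mk, LinearMap.sum_apply,
      sum_apply, sum_inner, Complex.re_sum]
    refine Finset.sum_congr rfl fun p _ => ?_
    change (inner ℂ (hT.rep p (ContinuousLinearMap.adjoint (hT.rep p) h)) h).re = _
    rw [← ContinuousLinearMap.adjoint_inner_right, inner_self_eq_norm_sq_to_K]
    simp [← Complex.ofReal_pow]
  have h3 : negBinom K.card n ≤ negBinom Γ.cliqueNum n :=
    negBinom_mono (SimpleGraph.IsClique.card_le_cliqueNum (tc := hK)) n
  rw [← h2]
  exact (sub_nonneg.1 h1).trans (mul_le_mul_of_nonneg_right h3 (sq_nonneg _))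

end Growth

/-! ### Convergence and norm of the Cauchy transform. -/

section Cauchy

open ArtinMonoid

variable {V : Type*} {Γ : SimpleGraph V} {H : Type*} [NormedAddCommGroup H]
  [InnerProductSpace ℂ H]

theorem inner_ell2Basis (p q : ArtinMonoid Γ) [Decidable (p = q)] :
    inner ℂ (ell2Basis p) (ell2Basis q) = if p = q then (1 : ℂ) else 0 := by
  classical
  rw [ell2Basis, ell2Basis, lp.inner_single_left, lp.single_apply]
  by_cases h : p = q
  · subst h; simp
  · simp [h]

/-- The isometry `h ↦ e_p ⊗ h`. -/
noncomputable def tmulBasis (p : ArtinMonoid Γ) : H →ₗᵢ[ℂ] CauchySpace Γ H where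
  toFun h := ((ell2Basis p ⊗ₜ[ℂ] h : lp (fun _ : ArtinMonoid Γ => ℂ) 2 ⊗[ℂ] H) : CauchySpace Γ H)
  map_add' x y := by rw [TensorProduct.tmul_add, UniformSpace.Completion.coe_add]
  map_smul' c x := by
    rw [TensorProduct.tmul_smul, UniformSpace.Completion.coe_smul]
    rfl
  norm_map' x := by
    classical
    have h1 : ‖ell2Basis p‖ = 1 := by
      rw [@norm_eq_sqrt_re_inner ℂ, inner_ell2Basis]
      simp
    change ‖((ell2Basis p ⊗ₜ[ℂ] x : lp (fun _ : ArtinMonoid Γ => ℂ) 2 ⊗[ℂ] H) :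
      CauchySpace Γ H)‖ = _
    rw [UniformSpace.Completion.norm_coe, TensorProduct.norm_tmul, h1, one_mul]

theorem orthogonalFamily_tmulBasis :
    OrthogonalFamily ℂ (fun _ : ArtinMonoid Γ => H) (fun p => tmulBasis (Γ := Γ) (H := H) p) := by
  classical
  intro p q hpq x y
  change inner ℂ ((ell2Basis p ⊗ₜ[ℂ] x : lp (fun _ : ArtinMonoid Γ => ℂ) 2 ⊗[ℂ] H) :
    CauchySpace Γ H) ((ell2Basis q ⊗ₜ[ℂ] y : lp (fun _ : ArtinMonoid Γ => ℂ) 2 ⊗[ℂ] H) :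
    CauchySpace Γ H) = 0
  rw [UniformSpace.Completion.inner_coe, TensorProduct.inner_tmul, inner_ell2Basis, if_neg hpq,
    zero_mul]

/-- Pythagoras on finite partial sums, then passage to the limit. -/
theorem OrthogonalFamily.norm_tsum_sq_le {ι E : Type*} {F : ι → Type*} [NormedAddCommGroup E]
    [InnerProductSpace ℂ E] [∀ i, NormedAddCommGroup (F i)] [∀ i, InnerProductSpace ℂ (F i)]
    {W : ∀ i, F i →ₗᵢ[ℂ] E} (hW : OrthogonalFamily ℂ F W) {f : ∀ i, F i}
    (hf : Summable fun i => W i (f i)) {c : ℝ} (hc : ∀ s : Finset ι, ∑ i ∈ s, ‖f i‖ ^ 2 ≤ c) :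
    ‖∑' i, W i (f i)‖ ^ 2 ≤ c := by
  refine le_of_tendsto (hf.hasSum.norm.pow 2) (Filter.Eventually.of_forall fun s => ?_)
  rw [hW.norm_sum]
  exact hc s

namespace IsGammaFamily

variable [CompleteSpace H] {T : V → H →L[ℂ] H}

theorem cauchyTerm_eq (hT : IsGammaFamily Γ T) (r : ℝ) (h : H) (p : ArtinMonoid Γ) :
    hT.cauchyTerm r h p =
      tmulBasis p (((r : ℂ) ^ length p) • ContinuousLinearMap.adjoint (hT.rep p) h) := rfl

/-- Grouping by length reduces this to `sum_sphere_le` and the binomial series at `x = r²`. -/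
theorem WeakBrehmer.sum_norm_sq_le [Finite V] {hT : IsGammaFamily Γ T} (hB : hT.WeakBrehmer)
    {r : ℝ} (hr0 : 0 ≤ r) (hr1 : r < 1) (h : H) (s : Finset (ArtinMonoid Γ)) :
    ∑ p ∈ s, ‖((r : ℂ) ^ length p) • ContinuousLinearMap.adjoint (hT.rep p) h‖ ^ 2 ≤
      1 / (1 - r ^ 2) ^ Γ.cliqueNum * ‖h‖ ^ 2 := by
  classical
  have hr2 : r ^ 2 < 1 := by nlinarith
  have hsum := (hasSum_negBinom Γ.cliqueNum (sq_nonneg r) hr2).mul_right (‖h‖ ^ 2)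
  set N := s.image length with hN
  have hterm : ∀ p : ArtinMonoid Γ,
      ‖((r : ℂ) ^ length p) • ContinuousLinearMap.adjoint (hT.rep p) h‖ ^ 2 =
      (r ^ 2) ^ length p * ‖ContinuousLinearMap.adjoint (hT.rep p) h‖ ^ 2 := by
    intro p
    rw [norm_smul, norm_pow, Complex.norm_real, Real.norm_of_nonneg hr0, mul_pow, ← pow_mul,
      ← pow_mul, mul_comm 2]
  calc ∑ p ∈ s, ‖((r : ℂ) ^ length p) • ContinuousLinearMap.adjoint (hT.rep p) h‖ ^ 2
      = ∑ n ∈ N, ∑ p ∈ s with length p = n,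
          (r ^ 2) ^ length p * ‖ContinuousLinearMap.adjoint (hT.rep p) h‖ ^ 2 := by
        rw [Finset.sum_fiberwise_of_maps_to fun p hp => Finset.mem_image_of_mem _ hp]
        exact Finset.sum_congr rfl fun p _ => hterm p
    _ ≤ ∑ n ∈ N, negBinom Γ.cliqueNum n * (r ^ 2) ^ n * ‖h‖ ^ 2 := by
        refine Finset.sum_le_sum fun n _ => ?_
        calc _ ≤ ∑ p ∈ sphere Γ n,
              (r ^ 2) ^ length p * ‖ContinuousLinearMap.adjoint (hT.rep p) h‖ ^ 2 :=
              Finset.sum_le_sum_of_subset_of_nonneg (fun p hp => by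
                simpa using (Finset.mem_filter.1 hp).2) fun p _ _ => by positivity
          _ = (r ^ 2) ^ n *
              ∑ p ∈ sphere Γ n, ‖ContinuousLinearMap.adjoint (hT.rep p) h‖ ^ 2 := by
              rw [Finset.mul_sum]
              exact Finset.sum_congr rfl fun p hp => by rw [mem_sphere.1 hp]
          _ ≤ (r ^ 2) ^ n * (negBinom Γ.cliqueNum n * ‖h‖ ^ 2) :=
              mul_le_mul_of_nonneg_left (hB.sum_sphere_le n h) (by positivity)
          _ = _ := by ring
    _ ≤ _ := sum_le_hasSum N (fun n _ => by
        have := negBinom_nonneg Γ.cliqueNum n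
        positivity) hsum

theorem WeakBrehmer.summable_cauchyTerm [Finite V] {hT : IsGammaFamily Γ T} (hB : hT.WeakBrehmer)
    {r : ℝ} (hr0 : 0 ≤ r) (hr1 : r < 1) (h : H) : Summable (hT.cauchyTerm r h) := by
  simp only [funext (hT.cauchyTerm_eq r h)]
  refine (orthogonalFamily_tmulBasis.summable_iff_norm_sq_summable _).2 ?_
  exact summable_of_sum_le (fun p => by positivity) (hB.sum_norm_sq_le hr0 hr1 h)

theorem WeakBrehmer.norm_cauchyTransform_sq_le [Finite V] {hT : IsGammaFamily Γ T}
    (hB : hT.WeakBrehmer) {r : ℝ} (hr0 : 0 ≤ r) (hr1 : r < 1) (h : H) :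
    ‖hT.cauchyTransform r h‖ ^ 2 ≤ 1 / (1 - r ^ 2) ^ Γ.cliqueNum * ‖h‖ ^ 2 :=
  orthogonalFamily_tmulBasis.norm_tsum_sq_le (hB.summable_cauchyTerm hr0 hr1 h)
    (hB.sum_norm_sq_le hr0 hr1 h)

theorem WeakBrehmer.isBoundedLinearMap_cauchyTransform [Finite V] {hT : IsGammaFamily Γ T}
    (hB : hT.WeakBrehmer) {r : ℝ} (hr0 : 0 ≤ r) (hr1 : r < 1) :
    IsBoundedLinearMap ℂ (hT.cauchyTransform r) := by
  have hs := hB.summable_cauchyTerm hr0 hr1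
  have hpos : 0 < 1 / (1 - r ^ 2) ^ Γ.cliqueNum := by
    have : 0 < 1 - r ^ 2 := by nlinarith
    positivity
  refine ⟨⟨fun x y => ?_, fun c x => ?_⟩, √(1 / (1 - r ^ 2) ^ Γ.cliqueNum), Real.sqrt_pos.2 hpos,
    fun h => ?_⟩
  · rw [cauchyTransform, cauchyTransform, cauchyTransform, ← (hs x).tsum_add (hs y)]
    refine tsum_congr fun p => ?_
    rw [cauchyTerm_eq, cauchyTerm_eq, cauchyTerm_eq, map_add, smul_add, map_add]
  · rw [cauchyTransform, cauchyTransform, ← (hs x).tsum_const_smul c]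
    refine tsum_congr fun p => ?_
    rw [cauchyTerm_eq, cauchyTerm_eq, (ContinuousLinearMap.adjoint (hT.rep p)).map_smul, smul_comm,
      LinearIsometry.map_smul]
  · refine le_of_sq_le_sq ?_ (by positivity)
    rw [mul_pow, Real.sq_sqrt hpos.le]
    exact hB.norm_cauchyTransform_sq_le hr0 hr1 h

end IsGammaFamily

end Cauchy

theorem mainTheorem3 {V : Type*} [Finite V] (Γ : SimpleGraph V) {H : Type*}
    [NormedAddCommGroup H] [InnerProductSpace ℂ H] [CompleteSpace H]
    (T : V → H →L[ℂ] H) (hT : IsGammaFamily Γ T) (hB : hT.WeakBrehmer)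
    (r : ℝ) (hr0 : 0 ≤ r) (hr1 : r < 1) :
    (∀ h : H, Summable (hT.cauchyTerm r h)) ∧
    IsBoundedLinearMap ℂ (hT.cauchyTransform r) ∧
    ∀ h : H, ‖hT.cauchyTransform r h‖ ^ 2 ≤ 1 / (1 - r ^ 2) ^ Γ.cliqueNum * ‖h‖ ^ 2 :=
  ⟨hB.summable_cauchyTerm hr0 hr1, hB.isBoundedLinearMap_cauchyTransform hr0 hr1,
    hB.norm_cauchyTransform_sq_le hr0 hr1⟩
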